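/- Let $(M,g)$ be a smooth semi-Riemannian manifold (arbitrary signature, possibly with boundary) of dimension $n\ge 3$, with Levi-Civita connection $\nabla$ and curvature convention $R^\alpha{}_{\beta\mu\nu}X^\beta=\nabla_\mu\nabla_\nu X^\alpha-\nabla_\nu\nabla_\mu X^\alpha$. Let $\mathrm{Ric}_g$ be the trace of $\mathrm{Riem}_g$ in the first and third indices, $\mathrm{Scal}_g=\mathrm{tr}_g\mathrm{Ric}_g$, $\mathrm{Sch}_g=\frac1{n-2}\bigl(\mathrm{Ric}_g-\frac{\mathrm{Scal}_g}{2(n-1)}g\bigr)$, and $$(\mathrm{Weyl}_g)_{\alpha\beta\mu\nu}=R_{\alpha\beta\mu\nu}-S_{\alpha\mu}g_{\beta\nu}+S_{\alpha\nu}g_{\beta\mu}+S_{\beta\mu}g_{\alpha\nu}-S_{\beta\nu}g_{\alpha\mu},\qquad S=\mathrm{Sch}_g .$$ Let $\Omega$ be a smooth function on $M$ and $\lambda\neq0$ a real constant such that $(M,g;\Omega)$ is Poincaré quasi-Einstein, that is, with $s=\frac1n(\Delta_g\Omega+\Omega\,\mathrm{tr}_g\mathrm{Sch}_g)$, $$\mathrm{Hess}_g\Omega+\Omega\,\mathrm{Sch}_g-s\,g=0,\qquad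 |\mathrm{grad}_g\Omega|_g^2-2s\Omega=-\lambda,$$ the vector field $\mathrm{grad}_g\Omega$ is geodesic ($\nabla_{\mathrm{grad}\,\Omega}\,\mathrm{grad}\,\Omega=0$), and $|\mathrm{grad}_g\Omega|_g^2=-\lambda$. Put $u=|\lambda|^{-1/2}\mathrm{grad}_g\Omega$ and $\epsilon=g(u,u)$, and let $\gamma^\alpha_\beta=\delta^\alpha_\beta-\epsilon u^\alpha u_\beta$, $K_{\alpha\beta}=\gamma^\mu_\alpha\gamma^\nu_\beta\nabla_\mu u_\nu$ (the second fundamental form of the level sets of $\Omega$), $K^{(2)}_{\alpha\beta}=K_{\alpha\rho}K^\rho{}_\beta$, and $(\mathrm{Weyl}_g^\perp)_{\beta\nu}=u^\alpha u^\mu(\mathrm{Weyl}_g)_{\alpha\beta\mu\nu}$. Then $\epsilon\in\{-1,1\}$ and $$\mathrm{Weyl}_g^\perp=K^{(2)}-\pounds_uK+\frac{\epsilon}{\Omega}|\lambda|^{1/2}K .$$ Here the formula holds as written where $\Omega\neq0$. Moreover there is exactly one continuous $(0,2)$-tensor field $Q$ on $M$ with $K=\Omega Q$; it is smooth, and $\mathrm{Weyl}_g^\perp=K^{(2)}-\pounds_uK+\epsilon|\lambda|^{1/2}Q$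 on all of $M$, including the points where $\Omega=0$. -/

import Mathlib

open Set
open scoped Manifold ContDiff

noncomputable section

/-- A smooth semi-Riemannian metric (of arbitrary signature) on the manifold `M`: a smooth section of
the bundle of bilinear forms on the tangent spaces which is symmetric and non-degenerate. Manifolds
with boundary are allowed. -/
structure SemiRiemannianMetric {n : ℕ} {H : Type*} [TopologicalSpace H]
    (I : ModelWithCorners ℝ (EuclideanSpace ℝ (Fin n)) H)
    (M : Type*) [TopologicalSpace M] [ChartedSpace H M] [IsManifold I ∞ M] where
  inner : ∀ p : M, TangentSpace I p →L[ℝ] TangentSpace I p →L[ℝ] ℝ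
  symm : ∀ (p : M) (v w : TangentSpace I p), inner p v w = inner p w v
  nondegenerate : ∀ (p : M) (v : TangentSpace I p), (∀ w, inner p v w = 0) → v = 0
  contMDiff : ContMDiff I
    (I.prod 𝓘(ℝ, EuclideanSpace ℝ (Fin n) →L[ℝ] EuclideanSpace ℝ (Fin n) →L[ℝ] ℝ)) ∞
    (fun p ↦ Bundle.TotalSpace.mk'
      (EuclideanSpace ℝ (Fin n) →L[ℝ] EuclideanSpace ℝ (Fin n) →L[ℝ] ℝ) p (inner p))

/-! Tensor calculus in a coordinate chart. The coordinates take values in the set `S`, which is the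
range of the model with corners (all of `ℝⁿ`, if there is no boundary), and `G` is the matrix of
components of the metric, as a function of the coordinates. -/

namespace Coord

variable {n : ℕ} (S : Set (EuclideanSpace ℝ (Fin n)))
  (G : EuclideanSpace ℝ (Fin n) → Matrix (Fin n) (Fin n) ℝ)

/-- The partial derivative `∂ᵢ f` (one-sided at boundary points of `S`). -/
def pd (i : Fin n) (f : EuclideanSpace ℝ (Fin n) → ℝ) (y : EuclideanSpace ℝ (Fin n)) : ℝ :=
  fderivWithin ℝ f S y (EuclideanSpace.single i (1 : ℝ))

/-- The Christoffel symbol `Γᵏᵢⱼ` of the Levi-Civita connection. -/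
def christoffel (k i j : Fin n) (y : EuclideanSpace ℝ (Fin n)) : ℝ :=
  (1 / 2) * ∑ l, (G y)⁻¹ k l *
    (pd S i (fun z ↦ G z j l) y + pd S j (fun z ↦ G z i l) y - pd S l (fun z ↦ G z i j) y)

/-- The curvature `Rᵃ_{bmn}`, with the sign `Rᵃ_{bmn} Xᵇ = ∇ₘ∇ₙXᵃ - ∇ₙ∇ₘXᵃ`. -/
def riemUp (a b m k : Fin n) (y : EuclideanSpace ℝ (Fin n)) : ℝ :=
  pd S m (christoffel S G a k b) y - pd S k (christoffel S G a m b) y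
    + ∑ c, (christoffel S G a m c y * christoffel S G c k b y
        - christoffel S G a k c y * christoffel S G c m b y)

/-- The Riemann `(0,4)`-tensor `R_{abmn}`. -/
def riem (a b m k : Fin n) (y : EuclideanSpace ℝ (Fin n)) : ℝ :=
  ∑ c, G y a c * riemUp S G c b m k y

/-- The Ricci tensor, the trace of the Riemann tensor in the first and third indices. -/
def ric (b k : Fin n) (y : EuclideanSpace ℝ (Fin n)) : ℝ :=
  ∑ a, riemUp S G a b a k y

/-- The trace of a `(0,2)`-tensor with respect to the metric. -/
def trace (T : Fin n → Fin n → EuclideanSpace ℝ (Fin n) → ℝ) (y : EuclideanSpace ℝ (Fin n)) : ℝ :=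
  ∑ a, ∑ b, (G y)⁻¹ a b * T a b y

/-- The scalar curvature. -/
def scal (y : EuclideanSpace ℝ (Fin n)) : ℝ := trace G (ric S G) y

/-- The Schouten tensor. -/
def schouten (a b : Fin n) (y : EuclideanSpace ℝ (Fin n)) : ℝ :=
  (1 / ((n : ℝ) - 2)) * (ric S G a b y - scal S G y / (2 * ((n : ℝ) - 1)) * G y a b)

/-- The Kulkarni–Nomizu product of two `(0,2)`-tensors. -/
def kulkarniNomizu (A B : Fin n → Fin n → EuclideanSpace ℝ (Fin n) → ℝ) (a b m k : Fin n)
    (y : EuclideanSpace ℝ (Fin n)) : ℝ :=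
  A a m y * B b k y - A a k y * B b m y - A b m y * B a k y + A b k y * B a m y

/-- The Weyl `(0,4)`-tensor. -/
def weyl (a b m k : Fin n) (y : EuclideanSpace ℝ (Fin n)) : ℝ :=
  riem S G a b m k y - kulkarniNomizu (schouten S G) (fun i j z ↦ G z i j) a b m k y

/-- The normal–normal part `T^⊥_{bk} = uᵃ uᵐ T_{abmk}` of a `(0,4)`-tensor with respect to `u`. -/
def normalNormal (u : Fin n → EuclideanSpace ℝ (Fin n) → ℝ)
    (T : Fin n → Fin n → Fin n → Fin n → EuclideanSpace ℝ (Fin n) → ℝ) (b k : Fin n)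
    (y : EuclideanSpace ℝ (Fin n)) : ℝ :=
  ∑ a, ∑ m, u a y * u m y * T a b m k y

/-- The gradient `gᵃᵇ ∂_b f`. -/
def grad (f : EuclideanSpace ℝ (Fin n) → ℝ) (a : Fin n) (y : EuclideanSpace ℝ (Fin n)) : ℝ :=
  ∑ b, (G y)⁻¹ a b * pd S b f y

/-- The one-form `X_a = g_{ab} Xᵇ` metrically related to a vector field. -/
def lower (X : Fin n → EuclideanSpace ℝ (Fin n) → ℝ) (a : Fin n)
    (y : EuclideanSpace ℝ (Fin n)) : ℝ :=
  ∑ b, G y a b * X b y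

/-- The square norm `g(X, X)` of a vector field. -/
def normSq (X : Fin n → EuclideanSpace ℝ (Fin n) → ℝ) (y : EuclideanSpace ℝ (Fin n)) : ℝ :=
  ∑ a, ∑ b, G y a b * X a y * X b y

/-- The covariant derivative `∇ₐ Xᵇ` of a vector field. -/
def covVec (X : Fin n → EuclideanSpace ℝ (Fin n) → ℝ) (a b : Fin n)
    (y : EuclideanSpace ℝ (Fin n)) : ℝ :=
  pd S a (X b) y + ∑ c, christoffel S G b a c y * X c y

/-- The covariant derivative `∇ₐ α_b` of a one-form. -/
def covForm (α : Fin n → EuclideanSpace ℝ (Fin n) → ℝ) (a b : Fin n)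
    (y : EuclideanSpace ℝ (Fin n)) : ℝ :=
  pd S a (α b) y - ∑ c, christoffel S G c a b y * α c y

/-- The Hessian `∇ₐ ∂_b f`. -/
def hess (f : EuclideanSpace ℝ (Fin n) → ℝ) (a b : Fin n) (y : EuclideanSpace ℝ (Fin n)) : ℝ :=
  covForm S G (fun c ↦ pd S c f) a b y

/-- The Laplacian. -/
def laplacian (f : EuclideanSpace ℝ (Fin n) → ℝ) (y : EuclideanSpace ℝ (Fin n)) : ℝ :=
  trace G (hess S G f) y

/-- The projector `γᵃ_b = δᵃ_b - ε uᵃ u_b`, with `ε = g(u, u)`, orthogonal to a unit vector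
field `u`. -/
def proj (u : Fin n → EuclideanSpace ℝ (Fin n) → ℝ) (a b : Fin n)
    (y : EuclideanSpace ℝ (Fin n)) : ℝ :=
  (if a = b then 1 else 0) - normSq G u y * u a y * lower G u b y

/-- The second fundamental form `K_{ab} = γᵐₐ γᵏ_b ∇ₘ uₖ` of the hypersurfaces with unit
normal `u`. -/
def secondFundamentalForm (u : Fin n → EuclideanSpace ℝ (Fin n) → ℝ) (a b : Fin n)
    (y : EuclideanSpace ℝ (Fin n)) : ℝ :=
  ∑ m, ∑ k, proj G u m a y * proj G u k b y * covForm S G (lower G u) m k y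

/-- The square `T⁽²⁾_{ab} = T_{ac} Tᶜ_b` of a `(0,2)`-tensor. -/
def tensorSq (T : Fin n → Fin n → EuclideanSpace ℝ (Fin n) → ℝ) (a b : Fin n)
    (y : EuclideanSpace ℝ (Fin n)) : ℝ :=
  ∑ c, ∑ d, T a c y * (G y)⁻¹ c d * T d b y

/-- The Lie derivative along the vector field `X` of a `(0,2)`-tensor. -/
def lieDeriv (X : Fin n → EuclideanSpace ℝ (Fin n) → ℝ)
    (T : Fin n → Fin n → EuclideanSpace ℝ (Fin n) → ℝ) (a b : Fin n)
    (y : EuclideanSpace ℝ (Fin n)) : ℝ :=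
  ∑ c, (X c y * pd S c (T a b) y + T c b y * pd S a (X c) y + T a c y * pd S b (X c) y)

/-- The scalar `s = (Δ_g Ω + Ω tr_g Sch_g) / n`. -/
def sScalar (Ω : EuclideanSpace ℝ (Fin n) → ℝ) (y : EuclideanSpace ℝ (Fin n)) : ℝ :=
  (1 / (n : ℝ)) * (laplacian S G Ω y + Ω y * trace G (schouten S G) y)

/-- The vector field `u = |λ|^{-1/2} grad_g Ω`. -/
def unitNormal (Ω : EuclideanSpace ℝ (Fin n) → ℝ) (lam : ℝ) (a : Fin n)
    (y : EuclideanSpace ℝ (Fin n)) : ℝ :=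
  (Real.sqrt |lam|)⁻¹ * grad S G Ω a y

/-- The second fundamental form `K` of the level sets of `Ω`, with respect to `u`. -/
def levelSetK (Ω : EuclideanSpace ℝ (Fin n) → ℝ) (lam : ℝ) :
    Fin n → Fin n → EuclideanSpace ℝ (Fin n) → ℝ :=
  secondFundamentalForm S G (unitNormal S G Ω lam)

/-- The tensor `Weyl_g^⊥`, with respect to `u`. -/
def weylPerp (Ω : EuclideanSpace ℝ (Fin n) → ℝ) (lam : ℝ) :
    Fin n → Fin n → EuclideanSpace ℝ (Fin n) → ℝ :=
  normalNormal (unitNormal S G Ω lam) (weyl S G)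

end Coord

section Manifold

variable {n : ℕ} {H : Type*} [TopologicalSpace H]
  {I : ModelWithCorners ℝ (EuclideanSpace ℝ (Fin n)) H}
  {M : Type*} [TopologicalSpace M] [ChartedSpace H M] [IsManifold I ∞ M]

/-- The components `g(∂ᵢ, ∂ⱼ)` of the metric in the chart `e`, as a function of the coordinates. -/
def SemiRiemannianMetric.coord (g : SemiRiemannianMetric I M) (e : OpenPartialHomeomorph M H)
    (y : EuclideanSpace ℝ (Fin n)) : Matrix (Fin n) (Fin n) ℝ :=
  Matrix.of fun i j ↦ g.inner ((e.extend I).symm y)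
    (mfderivWithin 𝓘(ℝ, EuclideanSpace ℝ (Fin n)) I (e.extend I).symm (range I) y
      (EuclideanSpace.single i (1 : ℝ) : EuclideanSpace ℝ (Fin n)))
    (mfderivWithin 𝓘(ℝ, EuclideanSpace ℝ (Fin n)) I (e.extend I).symm (range I) y
      (EuclideanSpace.single j (1 : ℝ) : EuclideanSpace ℝ (Fin n)))

variable (I) in
/-- The function `f` in the coordinates of the chart `e`. -/
def coordFun (e : OpenPartialHomeomorph M H) (f : M → ℝ) (y : EuclideanSpace ℝ (Fin n)) : ℝ :=
  f ((e.extend I).symm y)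

/-- `(M, g; Ω)` is quasi-Einstein with constant `λ`: in every smooth chart,
`Hess_g Ω + Ω Sch_g - s g = 0`, where `λ` is the constant given by `|grad_g Ω|² - 2 s Ω = -λ`. -/
structure IsQuasiEinstein (g : SemiRiemannianMetric I M) (Ω : M → ℝ) (lam : ℝ) : Prop where
  smooth : ContMDiff I 𝓘(ℝ, ℝ) ∞ Ω
  eq : ∀ e ∈ IsManifold.maximalAtlas I ∞ M, ∀ y ∈ (e.extend I).target, ∀ a b : Fin n,
    Coord.hess (range I) (g.coord e) (coordFun I e Ω) a b y
      + coordFun I e Ω y * Coord.schouten (range I) (g.coord e) a b y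
      - Coord.sScalar (range I) (g.coord e) (coordFun I e Ω) y * g.coord e y a b = 0
  const : ∀ e ∈ IsManifold.maximalAtlas I ∞ M, ∀ y ∈ (e.extend I).target,
    Coord.normSq (g.coord e) (Coord.grad (range I) (g.coord e) (coordFun I e Ω)) y
      - 2 * Coord.sScalar (range I) (g.coord e) (coordFun I e Ω) y * coordFun I e Ω y = -lam

/-- `(M, g; Ω)` is Poincaré quasi-Einstein with constant `λ`: it is quasi-Einstein with constant
`λ ≠ 0`, the gradient of `Ω` is geodesic, and `|grad_g Ω|² = -λ`. -/
structure IsPoincareQuasiEinstein (g : SemiRiemannianMetric I M) (Ω : M → ℝ) (lam : ℝ) : Prop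
    extends IsQuasiEinstein g Ω lam where
  ne_zero : lam ≠ 0
  geodesic : ∀ e ∈ IsManifold.maximalAtlas I ∞ M, ∀ y ∈ (e.extend I).target, ∀ b : Fin n,
    ∑ a, Coord.grad (range I) (g.coord e) (coordFun I e Ω) a y
      * Coord.covVec (range I) (g.coord e)
          (Coord.grad (range I) (g.coord e) (coordFun I e Ω)) a b y = 0
  norm_grad : ∀ e ∈ IsManifold.maximalAtlas I ∞ M, ∀ y ∈ (e.extend I).target,
    Coord.normSq (g.coord e) (Coord.grad (range I) (g.coord e) (coordFun I e Ω)) y = -lam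

end Manifold

end

/-! The norm condition turns the equation for `λ` into `sΩ = 0`. Since `|grad Ω|² = -λ ≠ 0`, the
gradient vanishes nowhere, so every neighbourhood of every point contains points with `Ω ≠ 0`. An
identity between continuous functions may therefore be divided by `Ω`. This gives `s = 0`, hence
`Hess Ω = -Ω Sch`. The geodesic condition says that `Hess Ω` annihilates `grad Ω`, so `Sch(u, ·) =
0` everywhere. Consequently `∇u♭ = -|λ|^{-1/2} Ω Sch` is symmetric and annihilated by `u`. It thus
equals `K`, and `K = ΩQ` with `Q = -|λ|^{-1/2} Sch`, which is smooth across the zeros of `Ω`. Two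
identities finish the proof. The Riccati equation `Riem^⊥ = K⁽²⁾ - £_u K` (`normalNormal_riem`)
comes from the Ricci identity contracted with `u`. Since `Sch(u, ·) = 0`, the Schouten part of
`Weyl^⊥` reduces to `-ε Sch = ε |λ|^{1/2} Q` (`normalNormal_weyl`). -/

namespace Coord

open Filter Topology

variable {n : ℕ} {S : Set (EuclideanSpace ℝ (Fin n))}
  {G : EuclideanSpace ℝ (Fin n) → Matrix (Fin n) (Fin n) ℝ} {y : EuclideanSpace ℝ (Fin n)}

/-! ### Rules for partial derivatives within `S`. -/

section PartialDerivative

variable {f h : EuclideanSpace ℝ (Fin n) → ℝ}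

lemma pd_congr (i : Fin n) (hy : y ∈ S) (hfh : f =ᶠ[𝓝[S] y] h) : pd S i f y = pd S i h y := by
  rw [pd, pd, hfh.fderivWithin_eq (hfh.eq_of_nhdsWithin hy)]

lemma pd_const (i : Fin n) (c : ℝ) : pd S i (fun _ ↦ c) y = 0 := by
  simp [pd]

lemma pd_sub (i : Fin n) (hS : UniqueDiffWithinAt ℝ S y) (hf : DifferentiableWithinAt ℝ f S y)
    (hh : DifferentiableWithinAt ℝ h S y) :
    pd S i (fun z ↦ f z - h z) y = pd S i f y - pd S i h y := by
  simp [pd, fderivWithin_fun_sub hS hf hh]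

lemma pd_mul (i : Fin n) (hS : UniqueDiffWithinAt ℝ S y) (hf : DifferentiableWithinAt ℝ f S y)
    (hh : DifferentiableWithinAt ℝ h S y) :
    pd S i (fun z ↦ f z * h z) y = f y * pd S i h y + h y * pd S i f y := by
  simp [pd, fderivWithin_fun_mul hS hf hh]

lemma pd_sum {ι : Type*} (s : Finset ι) {F : ι → EuclideanSpace ℝ (Fin n) → ℝ} (i : Fin n)
    (hS : UniqueDiffWithinAt ℝ S y) (hF : ∀ j ∈ s, DifferentiableWithinAt ℝ (F j) S y) :
    pd S i (fun z ↦ ∑ j ∈ s, F j z) y = ∑ j ∈ s, pd S i (F j) y := by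
  simp [pd, fderivWithin_fun_sum hS hF]

lemma contDiffWithinAt_pd (i : Fin n) (hS : UniqueDiffOn ℝ S) (hy : y ∈ S)
    (hf : ContDiffWithinAt ℝ ∞ f S y) : ContDiffWithinAt ℝ ∞ (pd S i f) S y :=
  hf.fderivWithin_right_apply contDiffWithinAt_const hS (by simp) hy

/-- At boundary points, symmetry of the second derivative is inherited from the interior; `S ⊆
closure (interior S)` makes this possible. -/
lemma pd_pd_comm (i j : Fin n) (hS : UniqueDiffOn ℝ S) (hcl : S ⊆ closure (interior S))
    (hy : y ∈ S) (hf : ContDiffWithinAt ℝ ∞ f S y) :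
    pd S i (pd S j f) y = pd S j (pd S i f) y := by
  have hd : DifferentiableWithinAt ℝ (fderivWithin ℝ f S) S y :=
    (hf.fderivWithin_right (m := 1) hS (by norm_cast) hy).differentiableWithinAt (by simp)
  have key : ∀ i j : Fin n, pd S i (pd S j f) y
      = fderivWithin ℝ (fderivWithin ℝ f S) S y (EuclideanSpace.single i 1)
        (EuclideanSpace.single j 1) := by
    intro i j
    unfold pd
    rw [fderivWithin_clm_apply (hS y hy) hd (differentiableWithinAt_const _)]
    simp
  rw [key, key]
  exact hf.isSymmSndFDerivWithinAt (by simp; norm_cast) hS (hcl hy) hy _ _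

end PartialDerivative

/-! ### Smoothness of the tensors built from the metric. -/

section Smoothness

variable {f : EuclideanSpace ℝ (Fin n) → ℝ}

lemma contDiffWithinAt_det {m : ℕ} {A : EuclideanSpace ℝ (Fin n) → Matrix (Fin m) (Fin m) ℝ}
    (hA : ∀ i j, ContDiffWithinAt ℝ ∞ (fun z ↦ A z i j) S y) :
    ContDiffWithinAt ℝ ∞ (fun z ↦ (A z).det) S y := by
  simp only [Matrix.det_apply']
  exact ContDiffWithinAt.sum fun σ _ ↦
    contDiffWithinAt_const.mul (contDiffWithinAt_prod fun i _ ↦ hA _ _)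

lemma contDiffWithinAt_inv (hG : ∀ i j, ContDiffWithinAt ℝ ∞ (fun z ↦ G z i j) S y)
    (hdet : (G y).det ≠ 0) (i j : Fin n) : ContDiffWithinAt ℝ ∞ (fun z ↦ (G z)⁻¹ i j) S y := by
  simp only [Matrix.inv_def, Matrix.smul_apply, Matrix.adjugate_apply, Ring.inverse_eq_inv',
    smul_eq_mul]
  refine ((contDiffWithinAt_det hG).inv hdet).mul (contDiffWithinAt_det fun k l ↦ ?_)
  -- The adjugate entry is the determinant of `G` with row `j` replaced by a constant unit vector.
  by_cases hk : k = j
  · subst hk; simpa using contDiffWithinAt_const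
  · simpa [Matrix.updateRow_ne hk] using hG k l

variable (hS : UniqueDiffOn ℝ S) (hy : y ∈ S)
  (hG : ∀ i j, ContDiffWithinAt ℝ ∞ (fun z ↦ G z i j) S y) (hdet : (G y).det ≠ 0)
include hS hy hG hdet

lemma contDiffWithinAt_christoffel (k i j : Fin n) :
    ContDiffWithinAt ℝ ∞ (christoffel S G k i j) S y :=
  contDiffWithinAt_const.mul <| ContDiffWithinAt.sum fun l _ ↦
    (contDiffWithinAt_inv hG hdet k l).mul <|
      ((contDiffWithinAt_pd i hS hy (hG j l)).add (contDiffWithinAt_pd j hS hy (hG i l))).sub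
        (contDiffWithinAt_pd l hS hy (hG i j))

lemma contDiffWithinAt_ric (b k : Fin n) : ContDiffWithinAt ℝ ∞ (ric S G b k) S y := by
  have hΓ := contDiffWithinAt_christoffel hS hy hG hdet
  exact ContDiffWithinAt.sum fun a _ ↦
    ((contDiffWithinAt_pd _ hS hy (hΓ _ _ _)).sub (contDiffWithinAt_pd _ hS hy (hΓ _ _ _))).add <|
      ContDiffWithinAt.sum fun c _ ↦ ((hΓ _ _ _).mul (hΓ _ _ _)).sub ((hΓ _ _ _).mul (hΓ _ _ _))

omit hS hy in
lemma contDiffWithinAt_trace {T : Fin n → Fin n → EuclideanSpace ℝ (Fin n) → ℝ}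
    (hT : ∀ a b, ContDiffWithinAt ℝ ∞ (T a b) S y) : ContDiffWithinAt ℝ ∞ (trace G T) S y :=
  ContDiffWithinAt.sum fun a _ ↦ ContDiffWithinAt.sum fun b _ ↦
    (contDiffWithinAt_inv hG hdet a b).mul (hT a b)

lemma contDiffWithinAt_schouten (a b : Fin n) :
    ContDiffWithinAt ℝ ∞ (schouten S G a b) S y := by
  have hric := contDiffWithinAt_ric hS hy hG hdet
  exact contDiffWithinAt_const.mul <| (hric a b).sub <|
    ((contDiffWithinAt_trace hG hdet hric).div_const _).mul (hG a b)

lemma contDiffWithinAt_covForm {α : Fin n → EuclideanSpace ℝ (Fin n) → ℝ}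
    (hα : ∀ a, ContDiffWithinAt ℝ ∞ (α a) S y) (a b : Fin n) :
    ContDiffWithinAt ℝ ∞ (covForm S G α a b) S y :=
  (contDiffWithinAt_pd a hS hy (hα b)).sub <| ContDiffWithinAt.sum fun c _ ↦
    (contDiffWithinAt_christoffel hS hy hG hdet c a b).mul (hα c)

lemma contDiffWithinAt_grad (hf : ContDiffWithinAt ℝ ∞ f S y) (a : Fin n) :
    ContDiffWithinAt ℝ ∞ (grad S G f a) S y :=
  ContDiffWithinAt.sum fun b _ ↦
    (contDiffWithinAt_inv hG hdet a b).mul (contDiffWithinAt_pd b hS hy hf)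

lemma contDiffWithinAt_sScalar (hf : ContDiffWithinAt ℝ ∞ f S y) :
    ContDiffWithinAt ℝ ∞ (sScalar S G f) S y :=
  contDiffWithinAt_const.mul <|
    (contDiffWithinAt_trace hG hdet <| contDiffWithinAt_covForm hS hy hG hdet fun c ↦
      contDiffWithinAt_pd c hS hy hf).add <|
    hf.mul (contDiffWithinAt_trace hG hdet (contDiffWithinAt_schouten hS hy hG hdet))

end Smoothness

/-! ### The Levi-Civita connection and the Ricci identity. -/

section LeviCivita

lemma christoffel_symm (hsymm : ∀ z i j, G z i j = G z j i) (k i j : Fin n) :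
    christoffel S G k i j y = christoffel S G k j i y := by
  simp only [christoffel, funext fun z ↦ hsymm z i j]
  congr 1
  exact Finset.sum_congr rfl fun l _ ↦ by ring

lemma sum_mul_inv_mul (hdet : (G y).det ≠ 0) (v : Fin n → ℝ) (d : Fin n) :
    ∑ c, G y d c * ∑ l, (G y)⁻¹ c l * v l = v d := by
  have : Matrix.mulVec (G y) (Matrix.mulVec ((G y)⁻¹) v) = v := by
    rw [Matrix.mulVec_mulVec, Matrix.mul_nonsing_inv _ (isUnit_iff_ne_zero.2 hdet), Matrix.one_mulVec]
  exact congrFun this d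

lemma sum_inv_mul_mul (hdet : (G y).det ≠ 0) (v : Fin n → ℝ) (d : Fin n) :
    ∑ c, (G y)⁻¹ d c * ∑ l, G y c l * v l = v d := by
  have : Matrix.mulVec ((G y)⁻¹) (Matrix.mulVec (G y) v) = v := by
    rw [Matrix.mulVec_mulVec, Matrix.nonsing_inv_mul _ (isUnit_iff_ne_zero.2 hdet), Matrix.one_mulVec]
  exact congrFun this d

/-- Lowering the upper index cancels the inverse metric and leaves the Christoffel symbols of the
first kind. -/
lemma sum_metric_mul_christoffel (hdet : (G y).det ≠ 0) (d i j : Fin n) :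
    ∑ c, G y d c * christoffel S G c i j y = (1 / 2) *
      (pd S i (fun z ↦ G z j d) y + pd S j (fun z ↦ G z i d) y - pd S d (fun z ↦ G z i j) y) := by
  rw [← sum_mul_inv_mul hdet (fun d ↦ (1 / 2) *
      (pd S i (fun z ↦ G z j d) y + pd S j (fun z ↦ G z i d) y - pd S d (fun z ↦ G z i j) y)) d]
  refine Finset.sum_congr rfl fun c _ ↦ ?_
  rw [christoffel, Finset.mul_sum]
  congr 1
  exact Finset.sum_congr rfl fun l _ ↦ by ring

/-- The Levi-Civita connection is compatible with the metric. -/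
lemma pd_metric (hsymm : ∀ z i j, G z i j = G z j i) (hdet : (G y).det ≠ 0) (a d e : Fin n) :
    pd S a (fun z ↦ G z d e) y = ∑ c, G y d c * christoffel S G c a e y
      + ∑ c, G y e c * christoffel S G c a d y := by
  rw [sum_metric_mul_christoffel hdet, sum_metric_mul_christoffel hdet]
  simp only [funext fun z ↦ hsymm z e d, funext fun z ↦ hsymm z a d, funext fun z ↦ hsymm z a e]
  ring

/-- Since `∇g = 0`, lowering an index commutes with `∇`. -/
lemma covForm_lower (hS : UniqueDiffOn ℝ S) (hy : y ∈ S)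
    (hG : ∀ i j, ContDiffWithinAt ℝ ∞ (fun z ↦ G z i j) S y) (hsymm : ∀ z i j, G z i j = G z j i)
    (hdet : (G y).det ≠ 0) {X : Fin n → EuclideanSpace ℝ (Fin n) → ℝ}
    (hX : ∀ a, ContDiffWithinAt ℝ ∞ (X a) S y) (a d : Fin n) :
    covForm S G (lower G X) a d y = ∑ e, G y d e * covVec S G X a e y := by
  have hp : pd S a (lower G X d) y
      = ∑ e, (G y d e * pd S a (X e) y + X e y * pd S a (fun z ↦ G z d e) y) := by
    unfold lower
    rw [pd_sum _ _ (hS y hy) fun j _ ↦ ((hG d j).mul (hX j)).differentiableWithinAt (by simp)]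
    exact Finset.sum_congr rfl fun e _ ↦ pd_mul _ (hS y hy)
      ((hG d e).differentiableWithinAt (by simp)) ((hX e).differentiableWithinAt (by simp))
  have h1 : ∑ e, X e y * ∑ c, G y e c * christoffel S G c a d y
      = ∑ c, christoffel S G c a d y * ∑ e, G y c e * X e y := by
    simp only [Finset.mul_sum]
    rw [Finset.sum_comm]
    refine Finset.sum_congr rfl fun c _ ↦ Finset.sum_congr rfl fun e _ ↦ ?_
    rw [hsymm y e c]; ring
  have h2 : ∑ e, X e y * ∑ c, G y d c * christoffel S G c a e y
      = ∑ e, G y d e * ∑ c, christoffel S G e a c y * X c y := by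
    simp only [Finset.mul_sum]
    rw [Finset.sum_comm]
    refine Finset.sum_congr rfl fun c _ ↦ Finset.sum_congr rfl fun e _ ↦ ?_
    ring
  rw [covForm, hp]
  simp only [covVec, pd_metric hsymm hdet, mul_add, Finset.sum_add_distrib, lower]
  rw [h1, h2]
  ring

/-- The connection is torsion-free, so `∇α` is symmetric whenever `dα = 0`. -/
lemma covForm_symm_of_pd_symm (hsymm : ∀ z i j, G z i j = G z j i)
    {α : Fin n → EuclideanSpace ℝ (Fin n) → ℝ} {a b : Fin n}
    (hα : pd S a (α b) y = pd S b (α a) y) : covForm S G α a b y = covForm S G α b a y := by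
  rw [covForm, covForm, hα]
  simp only [christoffel_symm hsymm _ a b]

/-- The Ricci identity for one-forms, in terms of partial derivatives. -/
lemma sum_mul_riemUp (hS : UniqueDiffOn ℝ S) (hcl : S ⊆ closure (interior S)) (hy : y ∈ S)
    (hG : ∀ i j, ContDiffWithinAt ℝ ∞ (fun z ↦ G z i j) S y) (hdet : (G y).det ≠ 0)
    {α : Fin n → EuclideanSpace ℝ (Fin n) → ℝ} (hα : ∀ a, ContDiffWithinAt ℝ ∞ (α a) S y)
    (b m k : Fin n) :
    ∑ c, α c y * riemUp S G c b m k y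
      = pd S k (covForm S G α m b) y - pd S m (covForm S G α k b) y
        - ∑ c, christoffel S G c k b y * covForm S G α m c y
        + ∑ c, christoffel S G c m b y * covForm S G α k c y := by
  have hΓ := contDiffWithinAt_christoffel hS hy hG hdet
  have hp : ∀ m k, pd S m (covForm S G α k b) y = pd S m (pd S k (α b)) y
      - ∑ c, (christoffel S G c k b y * pd S m (α c) y
        + α c y * pd S m (christoffel S G c k b) y) := by
    intro m k
    unfold covForm
    rw [pd_sub m (hS y hy) ((contDiffWithinAt_pd k hS hy (hα b)).differentiableWithinAt (by simp))
      ((ContDiffWithinAt.sum fun c _ ↦ (hΓ c k b).mul (hα c)).differentiableWithinAt (by simp)),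
      pd_sum _ _ (hS y hy) fun c _ ↦ ((hΓ c k b).mul (hα c)).differentiableWithinAt (by simp)]
    congr 1
    exact Finset.sum_congr rfl fun c _ ↦ pd_mul _ (hS y hy)
      ((hΓ c k b).differentiableWithinAt (by simp)) ((hα c).differentiableWithinAt (by simp))
  have hq : ∀ m k, ∑ c, christoffel S G c k b y * covForm S G α m c y
      = ∑ c, christoffel S G c k b y * pd S m (α c) y
        - ∑ c, α c y * ∑ d, christoffel S G c m d y * christoffel S G d k b y := by
    intro m k
    simp only [covForm, mul_sub, Finset.sum_sub_distrib, Finset.mul_sum]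
    congr 1
    rw [Finset.sum_comm]
    exact Finset.sum_congr rfl fun c _ ↦ Finset.sum_congr rfl fun e _ ↦ by ring
  -- The second derivatives of `α` cancel; what is left is linear in `α` with the coefficients of
  -- `riemUp`.
  rw [hp, hp, hq, hq, pd_pd_comm m k hS hcl hy (hα b)]
  simp only [riemUp, mul_add, mul_sub, Finset.sum_add_distrib, Finset.sum_sub_distrib]
  ring

end LeviCivita

end Coord

/-! ### From the manifold to charts: regularity and nondegeneracy of the components. -/

section Manifold

open Filter Topology

lemma contMDiffWithinAt_const_vectorField {E : Type*} [NormedAddCommGroup E] [NormedSpace ℝ E]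
    {s : Set E} {y : E} (v : E) :
    ContMDiffWithinAt 𝓘(ℝ, E) (𝓘(ℝ, E).tangent) ∞ (fun z : E ↦ (⟨z, v⟩ : TangentBundle 𝓘(ℝ, E) E))
      s y :=
  (contMDiffWithinAt_vectorSpace_iff_contDiffWithinAt (V := fun _ ↦ v)).2 contDiffWithinAt_const

variable {n : ℕ} {H : Type*} [TopologicalSpace H]
  {I : ModelWithCorners ℝ (EuclideanSpace ℝ (Fin n)) H}
  {M : Type*} [TopologicalSpace M] [ChartedSpace H M] [IsManifold I ∞ M]
  {e : OpenPartialHomeomorph M H} {y : EuclideanSpace ℝ (Fin n)}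

omit [ChartedSpace H M] [IsManifold I ∞ M] in
-- The chart target is relatively open in `range I`, so identities valid only on the target can be
-- differentiated within `range I`.
lemma OpenPartialHomeomorph.extend_target_mem_nhdsWithin_range (hy : y ∈ (e.extend I).target) :
    (e.extend I).target ∈ 𝓝[range I] y := by
  rw [e.extend_target] at hy ⊢
  exact inter_mem (mem_nhdsWithin_of_mem_nhds
    ((e.open_target.preimage I.continuous_symm).mem_nhds hy.1)) self_mem_nhdsWithin

omit [IsManifold I ∞ M] in
lemma contMDiffOn_extend_symm_target (he : e ∈ IsManifold.maximalAtlas I ∞ M) :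
    ContMDiffOn 𝓘(ℝ, EuclideanSpace ℝ (Fin n)) I ∞ (e.extend I).symm (e.extend I).target := by
  have := contMDiffOn_extend_symm he
  rwa [← e.extend_target'] at this

omit [IsManifold I ∞ M] in
lemma contMDiffWithinAt_extend_symm_range (he : e ∈ IsManifold.maximalAtlas I ∞ M)
    (hy : y ∈ (e.extend I).target) :
    ContMDiffWithinAt 𝓘(ℝ, EuclideanSpace ℝ (Fin n)) I ∞ (e.extend I).symm (range I) y :=
  (contMDiffOn_extend_symm_target he y hy).mono_of_mem_nhdsWithin
    (OpenPartialHomeomorph.extend_target_mem_nhdsWithin_range hy)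

omit [IsManifold I ∞ M] in
lemma contDiffWithinAt_coordFun (he : e ∈ IsManifold.maximalAtlas I ∞ M)
    (hy : y ∈ (e.extend I).target) {f : M → ℝ} (hf : ContMDiff I 𝓘(ℝ, ℝ) ∞ f) :
    ContDiffWithinAt ℝ ∞ (coordFun I e f) (range I) y :=
  contMDiffWithinAt_iff_contDiffWithinAt.1 <|
    hf.contMDiffAt.comp_contMDiffWithinAt y (contMDiffWithinAt_extend_symm_range he hy)

/-- The coordinate vector fields are smooth. -/
lemma contMDiffWithinAt_mfderivWithin_extend_symm (he : e ∈ IsManifold.maximalAtlas I ∞ M)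
    (hy : y ∈ (e.extend I).target) (v : EuclideanSpace ℝ (Fin n)) :
    ContMDiffWithinAt 𝓘(ℝ, EuclideanSpace ℝ (Fin n)) I.tangent ∞
      (fun z ↦ Bundle.TotalSpace.mk' (EuclideanSpace ℝ (Fin n)) (E := TangentSpace I)
        ((e.extend I).symm z) (mfderivWithin 𝓘(ℝ, EuclideanSpace ℝ (Fin n)) I (e.extend I).symm
          (range I) z v)) (range I) y := by
  have hu : UniqueDiffOn ℝ (e.extend I).target := by
    rw [e.extend_target, inter_comm]
    exact I.uniqueDiffOn.inter (e.open_target.preimage I.continuous_symm)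
  have h1 := (contMDiffOn_extend_symm_target he).contMDiffOn_tangentMapWithin (m := ∞) (by simp)
    hu.uniqueMDiffOn
  have h2 : ContMDiffWithinAt 𝓘(ℝ, EuclideanSpace ℝ (Fin n))
      (𝓘(ℝ, EuclideanSpace ℝ (Fin n)).tangent) ∞ (fun z : EuclideanSpace ℝ (Fin n) ↦
        (⟨z, v⟩ : TangentBundle 𝓘(ℝ, EuclideanSpace ℝ (Fin n)) (EuclideanSpace ℝ (Fin n))))
      (e.extend I).target y := contMDiffWithinAt_const_vectorField v
  have hmem := OpenPartialHomeomorph.extend_target_mem_nhdsWithin_range hy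
  have h3 := ((h1 ⟨y, v⟩ hy).comp y h2 fun z hz ↦ hz).mono_of_mem_nhdsWithin hmem
  -- The tangent map differentiates within the target, the metric components within `range I`; the
  -- derivatives agree because those within the smaller set are unique.
  have h4 : ∀ z ∈ (e.extend I).target,
      mfderivWithin 𝓘(ℝ, EuclideanSpace ℝ (Fin n)) I (e.extend I).symm (range I) z
        = mfderivWithin 𝓘(ℝ, EuclideanSpace ℝ (Fin n)) I (e.extend I).symm
          (e.extend I).target z := by
    intro z hz
    refine (((contMDiffWithinAt_extend_symm_range he hz).mdifferentiableWithinAt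
      (by simp)).mfderivWithin_mono (hu z hz).uniqueMDiffWithinAt
        (e.extend_target_subset_range)).symm
  refine h3.congr_of_eventuallyEq ?_ ?_
  · filter_upwards [hmem] with z hz
    simp only [Function.comp_def, tangentMapWithin, h4 z hz]
  · simp only [Function.comp_def, tangentMapWithin, h4 y hy]

lemma SemiRiemannianMetric.contDiffWithinAt_coord (g : SemiRiemannianMetric I M)
    (he : e ∈ IsManifold.maximalAtlas I ∞ M) (hy : y ∈ (e.extend I).target) (i j : Fin n) :
    ContDiffWithinAt ℝ ∞ (fun z ↦ g.coord e z i j) (range I) y := by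
  rw [← contMDiffWithinAt_iff_contDiffWithinAt]
  have : ContMDiffWithinAt 𝓘(ℝ, EuclideanSpace ℝ (Fin n)) (I.prod 𝓘(ℝ)) ∞
      (fun z ↦ Bundle.TotalSpace.mk' ℝ (E := Bundle.Trivial M ℝ) ((e.extend I).symm z)
        (g.coord e z i j)) (range I) y := by
    apply ContMDiffWithinAt.clm_bundle_apply₂ (F₁ := EuclideanSpace ℝ (Fin n))
      (F₂ := EuclideanSpace ℝ (Fin n)) (E₁ := TangentSpace I) (E₂ := TangentSpace I)
    · exact ContMDiffAt.comp_contMDiffWithinAt y g.contMDiff.contMDiffAt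
        (contMDiffWithinAt_extend_symm_range he hy)
    · exact contMDiffWithinAt_mfderivWithin_extend_symm he hy _
    · exact contMDiffWithinAt_mfderivWithin_extend_symm he hy _
  simp only [Bundle.contMDiffWithinAt_totalSpace] at this
  exact this.2

lemma SemiRiemannianMetric.coord_symm (g : SemiRiemannianMetric I M) (y) (i j : Fin n) :
    g.coord e y i j = g.coord e y j i :=
  g.symm _ _ _

omit [IsManifold I ∞ M] in
-- By the chain rule, the derivative of the chart is a left inverse.
lemma injective_mfderivWithin_extend_symm (he : e ∈ IsManifold.maximalAtlas I ∞ M)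
    (hy : y ∈ (e.extend I).target) :
    Function.Injective (mfderivWithin 𝓘(ℝ, EuclideanSpace ℝ (Fin n)) I (e.extend I).symm
      (range I) y) := by
  have hs : (e.extend I).symm y ∈ e.source := by
    simpa using (e.extend I).map_target hy
  have h1 : MDifferentiableAt I 𝓘(ℝ, EuclideanSpace ℝ (Fin n)) (e.extend I)
      ((e.extend I).symm y) := (e.contMDiffAt_extend he hs).mdifferentiableAt (by simp)
  have h2 := (contMDiffWithinAt_extend_symm_range he hy).mdifferentiableWithinAt (by simp)
  have hu : UniqueMDiffWithinAt 𝓘(ℝ, EuclideanSpace ℝ (Fin n)) (range I) y :=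
    (I.uniqueDiffOn y (e.extend_target_subset_range hy)).uniqueMDiffWithinAt
  have h3 := mfderiv_comp_mfderivWithin y h1 h2 hu
  have h4 : (e.extend I ∘ (e.extend I).symm) =ᶠ[𝓝[range I] y] id := by
    filter_upwards [OpenPartialHomeomorph.extend_target_mem_nhdsWithin_range hy] with z hz
    exact (e.extend I).right_inv hz
  rw [h4.mfderivWithin_eq ((e.extend I).right_inv hy), mfderivWithin_id hu] at h3
  intro v w hvw
  have h5 : ∀ v, mfderiv I 𝓘(ℝ, EuclideanSpace ℝ (Fin n)) (e.extend I) ((e.extend I).symm y)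
      (mfderivWithin 𝓘(ℝ, EuclideanSpace ℝ (Fin n)) I (e.extend I).symm (range I) y v) = v :=
    fun v ↦ (DFunLike.congr_fun h3 v).symm
  rw [← h5 v, hvw, h5]

/-- A kernel vector of the Gram matrix gives a tangent vector orthogonal to the coordinate frame.
The frame spans the tangent space, as an injective endomorphism in finite dimension is surjective,
so nondegeneracy forces the vector to be zero. -/
lemma SemiRiemannianMetric.det_coord_ne_zero (g : SemiRiemannianMetric I M)
    (he : e ∈ IsManifold.maximalAtlas I ∞ M) (hy : y ∈ (e.extend I).target) :
    (g.coord e y).det ≠ 0 := by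
  intro h0
  obtain ⟨v, hv, hGv⟩ := Matrix.exists_mulVec_eq_zero_iff.2 h0
  let D : EuclideanSpace ℝ (Fin n) →L[ℝ] EuclideanSpace ℝ (Fin n) :=
    mfderivWithin 𝓘(ℝ, EuclideanSpace ℝ (Fin n)) I (e.extend I).symm (range I) y
  have hD : Function.Injective D := injective_mfderivWithin_extend_symm he hy
  have hD' : Function.Surjective D := (LinearMap.injective_iff_surjective (f := D.toLinearMap)).1 hD
  let B : EuclideanSpace ℝ (Fin n) →L[ℝ] EuclideanSpace ℝ (Fin n) →L[ℝ] ℝ :=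
    g.inner ((e.extend I).symm y)
  have hG : ∀ i j, g.coord e y i j
      = B (D (EuclideanSpace.single i 1)) (D (EuclideanSpace.single j 1)) := fun _ _ ↦ rfl
  have hsum : ∀ w : EuclideanSpace ℝ (Fin n), w = ∑ i, w i • EuclideanSpace.single i (1 : ℝ) := by
    intro w
    ext j
    simp [Finset.sum_apply, Pi.single_apply]
  have h1 : ∀ i, B (D (EuclideanSpace.single i 1)) (D (WithLp.toLp 2 v)) = 0 := by
    intro i
    rw [hsum (WithLp.toLp 2 v)]
    simp only [map_sum, map_smul, smul_eq_mul, ← hG]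
    simpa [Matrix.mulVec, dotProduct, mul_comm] using congrFun hGv i
  have h2 : D (WithLp.toLp 2 v) = 0 := by
    refine g.nondegenerate ((e.extend I).symm y) _ fun w ↦ ?_
    obtain ⟨w', rfl⟩ := hD' w
    refine (g.symm _ _ _).trans ?_
    change B (D w') (D (WithLp.toLp 2 v)) = 0
    rw [hsum w']
    simp [h1]
  have h3 : WithLp.toLp 2 v = 0 := hD (h2.trans (map_zero D).symm)
  exact hv (by simpa using h3)

end Manifold

/-! ### The Riccati equation and the normal–normal part of Weyl. -/

namespace Coord

open Filter Topology

variable {n : ℕ} {S : Set (EuclideanSpace ℝ (Fin n))}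
  {G : EuclideanSpace ℝ (Fin n) → Matrix (Fin n) (Fin n) ℝ} {y : EuclideanSpace ℝ (Fin n)}

lemma pd_const_mul {f : EuclideanSpace ℝ (Fin n) → ℝ} (i : Fin n) (c : ℝ)
    (hS : UniqueDiffWithinAt ℝ S y) (hf : DifferentiableWithinAt ℝ f S y) :
    pd S i (fun z ↦ c * f z) y = c * pd S i f y := by
  rw [pd_mul i hS (differentiableWithinAt_const c) hf, pd_const, mul_zero, add_zero]

lemma covForm_congr {α β : Fin n → EuclideanSpace ℝ (Fin n) → ℝ} (hy : y ∈ S)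
    (h : ∀ b, α b =ᶠ[𝓝[S] y] β b) (a b : Fin n) : covForm S G α a b y = covForm S G β a b y := by
  simp only [covForm, pd_congr a hy (h b), fun c ↦ (h c).eq_of_nhdsWithin hy]

lemma covForm_const_mul {α : Fin n → EuclideanSpace ℝ (Fin n) → ℝ} (c : ℝ)
    (hS : UniqueDiffWithinAt ℝ S y) (hα : ∀ b, DifferentiableWithinAt ℝ (α b) S y) (a b : Fin n) :
    covForm S G (fun b z ↦ c * α b z) a b y = c * covForm S G α a b y := by
  simp only [covForm, pd_const_mul a c hS (hα b), mul_sub, Finset.mul_sum, mul_left_comm c]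

lemma lieDeriv_congr {X : Fin n → EuclideanSpace ℝ (Fin n) → ℝ}
    {A B : Fin n → Fin n → EuclideanSpace ℝ (Fin n) → ℝ} (hy : y ∈ S)
    (h : ∀ a b, A a b =ᶠ[𝓝[S] y] B a b) (a b : Fin n) :
    lieDeriv S X A a b y = lieDeriv S X B a b y := by
  simp only [lieDeriv, fun c ↦ pd_congr c hy (h a b), fun a b ↦ (h a b).eq_of_nhdsWithin hy]

lemma tensorSq_congr {A B : Fin n → Fin n → EuclideanSpace ℝ (Fin n) → ℝ}
    (h : ∀ a b, A a b y = B a b y) (a b : Fin n) : tensorSq G A a b y = tensorSq G B a b y := by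
  simp only [tensorSq, h]

/-- The Riccati equation for a geodesic vector field `u` with `∇u` symmetric and orthogonal
to `u`. -/
lemma normalNormal_riem (hS : UniqueDiffOn ℝ S) (hcl : S ⊆ closure (interior S)) (hy : y ∈ S)
    (hG : ∀ i j, ContDiffWithinAt ℝ ∞ (fun z ↦ G z i j) S y) (hsymm : ∀ z i j, G z i j = G z j i)
    (hdet : (G y).det ≠ 0) {u : Fin n → EuclideanSpace ℝ (Fin n) → ℝ}
    (hu : ∀ a, ContDiffWithinAt ℝ ∞ (u a) S y)
    (hA0 : ∀ b, ∀ᶠ z in 𝓝[S] y, ∑ m, u m z * covForm S G (lower G u) m b z = 0)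
    (hAs : ∀ a b, covForm S G (lower G u) a b =ᶠ[𝓝[S] y] covForm S G (lower G u) b a)
    (b k : Fin n) :
    normalNormal u (riem S G) b k y = tensorSq G (covForm S G (lower G u)) b k y
      - lieDeriv S u (covForm S G (lower G u)) b k y := by
  have hl : ∀ a, ContDiffWithinAt ℝ ∞ (lower G u a) S y := fun a ↦
    ContDiffWithinAt.sum fun c _ ↦ (hG a c).mul (hu c)
  have hA : ∀ a b, ContDiffWithinAt ℝ ∞ (covForm S G (lower G u) a b) S y :=
    contDiffWithinAt_covForm hS hy hG hdet hl
  have hcov : ∀ a c, ∑ d, (G y)⁻¹ c d * covForm S G (lower G u) a d y = covVec S G u a c y := by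
    intro a c
    simp only [covForm_lower hS hy hG hsymm hdet hu]
    exact sum_inv_mul_mul hdet (fun c ↦ covVec S G u a c y) c
  have hric := sum_mul_riemUp hS hcl hy hG hdet hl
  set A := covForm S G (lower G u) with hAdef
  have hs : ∀ a b, A a b y = A b a y := fun a b ↦ (hAs a b).eq_of_nhdsWithin hy
  have h0 : ∀ b, ∑ m, u m y * A m b y = 0 := fun b ↦ (hA0 b).self_of_nhdsWithin hy
  have hL : normalNormal u (riem S G) b k y
      = ∑ m, u m y * ∑ c, lower G u c y * riemUp S G c b m k y := by
    simp only [normalNormal, riem, lower, Finset.mul_sum, Finset.sum_mul]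
    rw [Finset.sum_comm]
    refine Finset.sum_congr rfl fun m _ ↦ ?_
    rw [Finset.sum_comm]
    refine Finset.sum_congr rfl fun c _ ↦ Finset.sum_congr rfl fun a _ ↦ ?_
    rw [hsymm y a c]; ring
  -- Differentiating `A(u, ·) = 0` moves the derivative from `A` onto `u`, producing one of the Lie
  -- derivative terms.
  have hd : ∑ m, u m y * pd S k (A m b) y = - ∑ m, A m b y * pd S k (u m) y := by
    have h := pd_congr k hy (h := fun _ ↦ 0) (hA0 b)
    rw [pd_const, pd_sum _ _ (hS y hy)
      fun m _ ↦ ((hu m).mul (hA m b)).differentiableWithinAt (by simp)] at h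
    rw [eq_neg_iff_add_eq_zero, ← Finset.sum_add_distrib, ← h]
    exact Finset.sum_congr rfl fun m _ ↦ (pd_mul _ (hS y hy)
      ((hu m).differentiableWithinAt (by simp)) ((hA m b).differentiableWithinAt (by simp))).symm
  have h1 : ∑ m, u m y * ∑ c, christoffel S G c k b y * A m c y = 0 := by
    simp only [Finset.mul_sum]
    rw [Finset.sum_comm]
    refine Finset.sum_eq_zero fun c _ ↦ ?_
    rw [← mul_zero (christoffel S G c k b y), ← h0 c, Finset.mul_sum]
    exact Finset.sum_congr rfl fun m _ ↦ by ring
  -- Raising the second index of `A = ∇u♭` gives `∇u`, so `A⁽²⁾` is `∇u` contracted with `A`; its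
  -- `∂u` part cancels against the Lie derivative.
  have h2 : tensorSq G A b k y = ∑ c, covVec S G u b c y * A c k y := by
    have : tensorSq G A b k y = ∑ d, (∑ c, (G y)⁻¹ d c * A b c y) * A d k y := by
      simp only [tensorSq, Finset.sum_mul]
      rw [Finset.sum_comm]
      refine Finset.sum_congr rfl fun d _ ↦ Finset.sum_congr rfl fun c _ ↦ ?_
      have hinv : (G y)⁻¹ c d = (G y)⁻¹ d c := by
        have : (G y).transpose = G y := by ext i j; exact hsymm y j i
        rw [← Matrix.transpose_apply (G y)⁻¹, Matrix.transpose_nonsing_inv, this]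
      rw [hinv]; ring
    rw [this]
    exact Finset.sum_congr rfl fun d _ ↦ by rw [hcov]
  have h3 : ∑ m, u m y * ∑ c, christoffel S G c m b y * A k c y
      = ∑ c, (∑ m, christoffel S G c b m y * u m y) * A c k y := by
    simp only [Finset.mul_sum, Finset.sum_mul]
    rw [Finset.sum_comm]
    refine Finset.sum_congr rfl fun c _ ↦ Finset.sum_congr rfl fun m _ ↦ ?_
    rw [christoffel_symm hsymm c m b, hs k c]; ring
  have h4 : ∑ m, u m y * pd S m (A k b) y = ∑ m, u m y * pd S m (A b k) y :=
    Finset.sum_congr rfl fun m _ ↦ by rw [pd_congr m hy (hAs k b)]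
  have h5 : ∑ c, A b c y * pd S k (u c) y = ∑ c, A c b y * pd S k (u c) y :=
    Finset.sum_congr rfl fun c _ ↦ by rw [hs b c]
  have h6 : ∑ c, A c k y * pd S b (u c) y = ∑ c, pd S b (u c) y * A c k y :=
    Finset.sum_congr rfl fun c _ ↦ mul_comm _ _
  rw [hL, h2]
  simp only [hric, lieDeriv, covVec, mul_add, mul_sub, Finset.sum_add_distrib,
    Finset.sum_sub_distrib, add_mul]
  rw [hd, h1, h3, h4, h5, h6]
  ring

/-- The second fundamental form is `∇u` if the latter is orthogonal to `u` in both slots. -/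
lemma secondFundamentalForm_eq_covForm {u : Fin n → EuclideanSpace ℝ (Fin n) → ℝ}
    (hl : ∀ b, ∑ m, u m y * covForm S G (lower G u) m b y = 0)
    (hr : ∀ a, ∑ k, u k y * covForm S G (lower G u) a k y = 0) (a b : Fin n) :
    secondFundamentalForm S G u a b y = covForm S G (lower G u) a b y := by
  -- The projector fixes covectors that annihilate `u`.
  have key : ∀ (F : Fin n → ℝ) (a : Fin n), ∑ m, u m y * F m = 0 →
      ∑ m, proj G u m a y * F m = F a := by
    intro F a hF
    simp only [proj, sub_mul, Finset.sum_sub_distrib, ite_mul, one_mul, zero_mul,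
      Finset.sum_ite_eq', Finset.mem_univ, if_true]
    have : ∑ m, normSq G u y * u m y * lower G u a y * F m
        = normSq G u y * lower G u a y * ∑ m, u m y * F m := by
      rw [Finset.mul_sum]
      exact Finset.sum_congr rfl fun m _ ↦ by ring
    rw [this, hF, mul_zero, sub_zero]
  have : secondFundamentalForm S G u a b y
      = ∑ m, proj G u m a y * ∑ k, proj G u k b y * covForm S G (lower G u) m k y := by
    simp only [secondFundamentalForm, Finset.mul_sum, mul_assoc]
  rw [this]
  simp only [fun m ↦ key (fun k ↦ covForm S G (lower G u) m k y) b (hr m)]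
  exact key (fun m ↦ covForm S G (lower G u) m b y) a (hl b)

/-- Of the four Kulkarni–Nomizu terms, three contract `u` into the Schouten tensor; only `S_{bk}
g_{am}` survives. -/
lemma normalNormal_weyl {u : Fin n → EuclideanSpace ℝ (Fin n) → ℝ}
    (hl : ∀ b, ∑ a, u a y * schouten S G a b y = 0)
    (hr : ∀ a, ∑ b, u b y * schouten S G a b y = 0) (b k : Fin n) :
    normalNormal u (weyl S G) b k y
      = normalNormal u (riem S G) b k y - normSq G u y * schouten S G b k y := by
  have h1 : ∑ a, ∑ m, u a y * u m y * (schouten S G a m y * G y b k) = 0 := by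
    have : ∀ a, ∑ m, u a y * u m y * (schouten S G a m y * G y b k)
        = u a y * G y b k * ∑ m, u m y * schouten S G a m y := fun a ↦ by
      rw [Finset.mul_sum]
      exact Finset.sum_congr rfl fun m _ ↦ by ring
    simp [this, hr]
  have h2 : ∑ a, ∑ m, u a y * u m y * (schouten S G a k y * G y b m) = 0 := by
    rw [Finset.sum_comm]
    have : ∀ m, ∑ a, u a y * u m y * (schouten S G a k y * G y b m)
        = u m y * G y b m * ∑ a, u a y * schouten S G a k y := fun a ↦ by
      rw [Finset.mul_sum]
      exact Finset.sum_congr rfl fun m _ ↦ by ring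
    simp [this, hl]
  have h3 : ∑ a, ∑ m, u a y * u m y * (schouten S G b m y * G y a k) = 0 := by
    have : ∀ a, ∑ m, u a y * u m y * (schouten S G b m y * G y a k)
        = u a y * G y a k * ∑ m, u m y * schouten S G b m y := fun a ↦ by
      rw [Finset.mul_sum]
      exact Finset.sum_congr rfl fun m _ ↦ by ring
    simp [this, hr]
  have h4 : ∑ a, ∑ m, u a y * u m y * (schouten S G b k y * G y a m)
      = normSq G u y * schouten S G b k y := by
    simp only [normSq, Finset.sum_mul]
    exact Finset.sum_congr rfl fun a _ ↦ Finset.sum_congr rfl fun m _ ↦ by ring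
  simp only [normalNormal, weyl, kulkarniNomizu, mul_add, mul_sub, Finset.sum_add_distrib,
    Finset.sum_sub_distrib]
  rw [h1, h2, h3, h4]
  ring

lemma normSq_const_mul (c : ℝ) (X : Fin n → EuclideanSpace ℝ (Fin n) → ℝ) :
    normSq G (fun a z ↦ c * X a z) y = c ^ 2 * normSq G X y := by
  simp only [normSq, Finset.mul_sum]
  exact Finset.sum_congr rfl fun a _ ↦ Finset.sum_congr rfl fun b _ ↦ by ring

/-- Here `ε = -λ/|λ|`. -/
lemma normSq_unitNormal {f : EuclideanSpace ℝ (Fin n) → ℝ} {lam : ℝ} (hlam : lam ≠ 0)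
    (h : normSq G (grad S G f) y = -lam) :
    normSq G (unitNormal S G f lam) y = 1 ∨ normSq G (unitNormal S G f lam) y = -1 := by
  have : normSq G (unitNormal S G f lam) y = |lam|⁻¹ * -lam := by
    rw [show unitNormal S G f lam = fun a z ↦ (√|lam|)⁻¹ * grad S G f a z from rfl,
      normSq_const_mul, h, inv_pow, Real.sq_sqrt (abs_nonneg _)]
  rw [this]
  rcases lt_or_gt_of_ne hlam with h | h
  · left; rw [abs_of_neg h]; field_simp
  · right; rw [abs_of_pos h]; field_simp

lemma lower_unitNormal (hdet : (G y).det ≠ 0) (f : EuclideanSpace ℝ (Fin n) → ℝ) (lam : ℝ)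
    (a : Fin n) : lower G (unitNormal S G f lam) a y = (√|lam|)⁻¹ * pd S a f y := by
  rw [← sum_mul_inv_mul hdet (fun b ↦ pd S b f y) a, Finset.mul_sum]
  refine Finset.sum_congr rfl fun c _ ↦ ?_
  rw [unitNormal, grad]; ring

lemma lower_grad (hdet : (G y).det ≠ 0) (f : EuclideanSpace ℝ (Fin n) → ℝ) (a : Fin n) :
    lower G (grad S G f) a y = pd S a f y :=
  sum_mul_inv_mul hdet (fun b ↦ pd S b f y) a

/-- A function does not vanish identically near a point where its gradient is not null. -/
lemma frequently_ne_zero (hy : y ∈ S) {f : EuclideanSpace ℝ (Fin n) → ℝ}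
    (h : normSq G (grad S G f) y ≠ 0) : ∃ᶠ z in 𝓝[S] y, f z ≠ 0 := by
  intro h0
  refine h ?_
  have hz : ∀ b, pd S b f y = 0 := fun b ↦ by
    rw [pd_congr b hy (h := fun _ ↦ 0) (h0.mono fun z hz ↦ not_not.1 hz), pd_const]
  simp [normSq, grad, hz]

/-- This extends identities obtained by dividing by `Ω` to its zeros. -/
lemma eq_of_frequently_eq {X : Type*} [TopologicalSpace X] {S : Set X} {y : X} {p q : X → ℝ}
    (hp : ContinuousWithinAt p S y) (hq : ContinuousWithinAt q S y)
    (h : ∃ᶠ z in 𝓝[S] y, p z = q z) : p y = q y := by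
  by_contra hne
  exact h (((hp.sub hq).eventually_ne (sub_ne_zero.2 hne)).mono fun z hz ↦ sub_ne_zero.1 hz)

end Coord

/-! ### Consequences of the Poincaré quasi-Einstein equations in a chart. -/

namespace Coord

open Filter Topology

variable {n : ℕ} {S T : Set (EuclideanSpace ℝ (Fin n))}
  {G : EuclideanSpace ℝ (Fin n) → Matrix (Fin n) (Fin n) ℝ}
  {f : EuclideanSpace ℝ (Fin n) → ℝ} {lam : ℝ}

/-- `f` is a Poincaré quasi-Einstein function for the smooth metric `G` on the relatively open
subset `T` of `S`. -/
structure IsPoincareQuasiEinsteinOn (S T : Set (EuclideanSpace ℝ (Fin n)))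
    (G : EuclideanSpace ℝ (Fin n) → Matrix (Fin n) (Fin n) ℝ) (f : EuclideanSpace ℝ (Fin n) → ℝ)
    (lam : ℝ) : Prop where
  uniqueDiffOn : UniqueDiffOn ℝ S
  subset_closure : S ⊆ closure (interior S)
  subset : T ⊆ S
  mem_nhdsWithin : ∀ y ∈ T, T ∈ 𝓝[S] y
  smooth_metric : ∀ y ∈ T, ∀ i j, ContDiffWithinAt ℝ ∞ (fun z ↦ G z i j) S y
  symm : ∀ z i j, G z i j = G z j i
  det_ne_zero : ∀ y ∈ T, (G y).det ≠ 0
  smooth : ∀ y ∈ T, ContDiffWithinAt ℝ ∞ f S y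
  ne_zero : lam ≠ 0
  eq : ∀ y ∈ T, ∀ a b, hess S G f a b y + f y * schouten S G a b y - sScalar S G f y * G y a b = 0
  const : ∀ y ∈ T, normSq G (grad S G f) y - 2 * sScalar S G f y * f y = -lam
  geodesic : ∀ y ∈ T, ∀ b, ∑ a, grad S G f a y * covVec S G (grad S G f) a b y = 0
  norm_grad : ∀ y ∈ T, normSq G (grad S G f) y = -lam

namespace IsPoincareQuasiEinsteinOn

variable (h : IsPoincareQuasiEinsteinOn S T G f lam) {y : EuclideanSpace ℝ (Fin n)} (hy : y ∈ T)
include h hy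

lemma frequently : ∃ᶠ z in 𝓝[S] y, f z ≠ 0 ∧ z ∈ T :=
  (frequently_ne_zero (h.subset hy) ((h.norm_grad y hy).trans_ne (neg_ne_zero.2 h.ne_zero))).and_eventually
    (h.mem_nhdsWithin y hy)

lemma contDiffWithinAt_schouten (a b : Fin n) :
    ContDiffWithinAt ℝ ∞ (schouten S G a b) S y :=
  Coord.contDiffWithinAt_schouten h.uniqueDiffOn (h.subset hy) (h.smooth_metric y hy)
    (h.det_ne_zero y hy) a b

lemma contDiffWithinAt_unitNormal (a : Fin n) :
    ContDiffWithinAt ℝ ∞ (unitNormal S G f lam a) S y :=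
  contDiffWithinAt_const.mul <| contDiffWithinAt_grad h.uniqueDiffOn (h.subset hy)
    (h.smooth_metric y hy) (h.det_ne_zero y hy) (h.smooth y hy) a

/-- Comparing the two expressions for `-λ` gives `sΩ = 0`; divide by `Ω` and use continuity. -/
lemma sScalar_eq_zero : sScalar S G f y = 0 := by
  refine eq_of_frequently_eq (q := fun _ ↦ 0)
    (contDiffWithinAt_sScalar h.uniqueDiffOn (h.subset hy) (h.smooth_metric y hy)
      (h.det_ne_zero y hy) (h.smooth y hy)).continuousWithinAt continuousWithinAt_const
    ((h.frequently hy).mono fun z hz ↦ ?_)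
  have h1 := h.const z hz.2
  rw [h.norm_grad z hz.2] at h1
  have h2 : sScalar S G f z * f z = 0 := by linarith
  exact (mul_eq_zero.1 h2).resolve_right hz.1

lemma hess_eq (a b : Fin n) : hess S G f a b y = - (f y * schouten S G a b y) := by
  have := h.eq y hy a b
  rw [h.sScalar_eq_zero hy] at this
  linarith

lemma hess_symm (a b : Fin n) : hess S G f a b y = hess S G f b a y :=
  covForm_symm_of_pd_symm h.symm <|
    pd_pd_comm a b h.uniqueDiffOn h.subset_closure (h.subset hy) (h.smooth y hy)

/-- This is the geodesic condition with its free index lowered. -/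
lemma sum_grad_mul_hess (b : Fin n) : ∑ a, grad S G f a y * hess S G f a b y = 0 := by
  have hc : ∀ a, hess S G f a b y = ∑ e, G y b e * covVec S G (grad S G f) a e y := fun a ↦ by
    rw [← covForm_lower h.uniqueDiffOn (h.subset hy) (h.smooth_metric y hy) h.symm
      (h.det_ne_zero y hy) (contDiffWithinAt_grad h.uniqueDiffOn (h.subset hy)
        (h.smooth_metric y hy) (h.det_ne_zero y hy) (h.smooth y hy))]
    exact covForm_congr (h.subset hy) (fun c ↦ by
      filter_upwards [h.mem_nhdsWithin y hy] with z hz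
      exact (lower_grad (h.det_ne_zero z hz) f c).symm) a b
  simp only [hc, Finset.mul_sum]
  rw [Finset.sum_comm]
  refine Finset.sum_eq_zero fun e _ ↦ ?_
  rw [← mul_zero (G y b e), ← h.geodesic y hy e, Finset.mul_sum]
  exact Finset.sum_congr rfl fun a _ ↦ by ring

/-- Symmetry is inherited from `Hess Ω = -Ω Sch` where `Ω ≠ 0`, so the Bianchi identity is not
needed. -/
lemma schouten_symm (a b : Fin n) : schouten S G a b y = schouten S G b a y := by
  refine eq_of_frequently_eq (h.contDiffWithinAt_schouten hy a b).continuousWithinAt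
    (h.contDiffWithinAt_schouten hy b a).continuousWithinAt
    ((h.frequently hy).mono fun z hz ↦ ?_)
  have := h.hess_symm hz.2 a b
  rw [h.hess_eq hz.2, h.hess_eq hz.2, neg_inj] at this
  exact mul_left_cancel₀ hz.1 this

lemma sum_unitNormal_mul_schouten (b : Fin n) :
    ∑ a, unitNormal S G f lam a y * schouten S G a b y = 0 := by
  refine eq_of_frequently_eq (p := fun y ↦ ∑ a, unitNormal S G f lam a y * schouten S G a b y)
    (q := fun _ ↦ 0) (ContDiffWithinAt.continuousWithinAt (n := ∞) (𝕜 := ℝ) <|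
      ContDiffWithinAt.sum fun a _ ↦ (h.contDiffWithinAt_unitNormal hy a).mul
        (h.contDiffWithinAt_schouten hy a b)) continuousWithinAt_const
    ((h.frequently hy).mono fun z hz ↦ mul_left_cancel₀ hz.1 ?_)
  have h0 := h.sum_grad_mul_hess hz.2 b
  simp only [h.hess_eq hz.2] at h0
  rw [mul_zero, ← mul_zero (-(√|lam|)⁻¹), ← h0, Finset.mul_sum, Finset.mul_sum]
  refine Finset.sum_congr rfl fun a _ ↦ ?_
  rw [unitNormal]; ring

/-- `u♭` is a constant multiple of `dΩ`, so its covariant derivative is a multiple of the Hessian.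
The bracket is the tensor `Q` of the theorem. -/
lemma covForm_lower_unitNormal (a b : Fin n) :
    covForm S G (lower G (unitNormal S G f lam)) a b y
      = f y * (-(√|lam|)⁻¹ * schouten S G a b y) := by
  rw [covForm_congr (h.subset hy) (β := fun b z ↦ (√|lam|)⁻¹ * pd S b f z) fun c ↦ by
      filter_upwards [h.mem_nhdsWithin y hy] with z hz
      exact lower_unitNormal (h.det_ne_zero z hz) f lam c,
    covForm_const_mul _ (h.uniqueDiffOn y (h.subset hy)) fun b ↦
      (contDiffWithinAt_pd b h.uniqueDiffOn (h.subset hy) (h.smooth y hy)).differentiableWithinAt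
        (by simp)]
  change _ * hess S G f a b y = _
  rw [h.hess_eq hy]; ring

lemma sum_unitNormal_mul_covForm (b : Fin n) :
    ∑ a, unitNormal S G f lam a y * covForm S G (lower G (unitNormal S G f lam)) a b y = 0 := by
  simp only [h.covForm_lower_unitNormal hy]
  rw [← mul_zero (-(f y * (√|lam|)⁻¹)), ← h.sum_unitNormal_mul_schouten hy b, Finset.mul_sum]
  exact Finset.sum_congr rfl fun a _ ↦ by ring

lemma covForm_unitNormal_symm (a b : Fin n) :
    covForm S G (lower G (unitNormal S G f lam)) a b y
      = covForm S G (lower G (unitNormal S G f lam)) b a y := by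
  rw [h.covForm_lower_unitNormal hy, h.covForm_lower_unitNormal hy, h.schouten_symm hy]

lemma levelSetK_eq_covForm (a b : Fin n) :
    levelSetK S G f lam a b y = covForm S G (lower G (unitNormal S G f lam)) a b y :=
  secondFundamentalForm_eq_covForm (h.sum_unitNormal_mul_covForm hy)
    (fun a ↦ by
      simp only [h.covForm_unitNormal_symm hy a]
      exact h.sum_unitNormal_mul_covForm hy a) a b

lemma levelSetK_eq (a b : Fin n) :
    levelSetK S G f lam a b y = f y * (-(√|lam|)⁻¹ * schouten S G a b y) := by
  rw [h.levelSetK_eq_covForm hy, h.covForm_lower_unitNormal hy]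

/-- The last term is `-ε Sch` written through `Q`. No division by `Ω` occurs, so zeros of `Ω` are
covered. -/
lemma weylPerp_eq (b k : Fin n) :
    weylPerp S G f lam b k y
      = tensorSq G (levelSetK S G f lam) b k y
        - lieDeriv S (unitNormal S G f lam) (levelSetK S G f lam) b k y
        + normSq G (unitNormal S G f lam) y * √|lam| * (-(√|lam|)⁻¹ * schouten S G b k y) := by
  have hr : √|lam| ≠ 0 := Real.sqrt_ne_zero'.2 (abs_pos.2 h.ne_zero)
  rw [weylPerp, normalNormal_weyl (h.sum_unitNormal_mul_schouten hy)
      (fun a ↦ by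
        simp only [h.schouten_symm hy a]
        exact h.sum_unitNormal_mul_schouten hy a),
    normalNormal_riem h.uniqueDiffOn h.subset_closure (h.subset hy) (h.smooth_metric y hy) h.symm
      (h.det_ne_zero y hy) (h.contDiffWithinAt_unitNormal hy)
      (fun b ↦ by
        filter_upwards [h.mem_nhdsWithin y hy] with z hz
        exact h.sum_unitNormal_mul_covForm hz b)
      (fun a b ↦ by
        filter_upwards [h.mem_nhdsWithin y hy] with z hz
        exact h.covForm_unitNormal_symm hz a b),
    tensorSq_congr (h.levelSetK_eq_covForm hy),
    lieDeriv_congr (A := levelSetK S G f lam) (h.subset hy) (fun a b ↦ by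
        filter_upwards [h.mem_nhdsWithin y hy] with z hz
        exact h.levelSetK_eq_covForm hz a b)]
  field_simp
  ring

end IsPoincareQuasiEinsteinOn

end Coord

/-! ### Transfer to charts and conclusion. -/

lemma IsPoincareQuasiEinstein.isPoincareQuasiEinsteinOn {n : ℕ} {H : Type*} [TopologicalSpace H]
    {I : ModelWithCorners ℝ (EuclideanSpace ℝ (Fin n)) H}
    {M : Type*} [TopologicalSpace M] [ChartedSpace H M] [IsManifold I ∞ M]
    {g : SemiRiemannianMetric I M} {Ω : M → ℝ} {lam : ℝ}
    (hg : IsPoincareQuasiEinstein g Ω lam)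
    {e : OpenPartialHomeomorph M H} (he : e ∈ IsManifold.maximalAtlas I ∞ M) :
    Coord.IsPoincareQuasiEinsteinOn (range I) (e.extend I).target (g.coord e) (coordFun I e Ω)
      lam where
  uniqueDiffOn := I.uniqueDiffOn
  subset_closure := I.range_subset_closure_interior
  subset := e.extend_target_subset_range
  mem_nhdsWithin _ hy := OpenPartialHomeomorph.extend_target_mem_nhdsWithin_range hy
  smooth_metric _ hy := g.contDiffWithinAt_coord he hy
  symm := g.coord_symm
  det_ne_zero _ hy := g.det_coord_ne_zero he hy
  smooth _ hy := contDiffWithinAt_coordFun he hy hg.smooth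
  ne_zero := hg.ne_zero
  eq := hg.eq e he
  const := hg.const e he
  geodesic := hg.geodesic e he
  norm_grad := hg.norm_grad e he

/-- In every smooth chart: the normal–normal Weyl component equals
`K⁽²⁾ - £_u K + (ε/Ω) |λ|^{1/2} K` where `Ω ≠ 0`. Moreover `K = Ω Q` for a (unique) smooth tensor `Q`,
and with `Q` in place of `K/Ω` the formula holds everywhere, also where `Ω = 0`. -/
theorem mainTheorem5 {n : ℕ} (hn : 3 ≤ n) {H : Type*} [TopologicalSpace H]
    (I : ModelWithCorners ℝ (EuclideanSpace ℝ (Fin n)) H)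
    {M : Type*} [TopologicalSpace M] [ChartedSpace H M] [IsManifold I ∞ M]
    (g : SemiRiemannianMetric I M) (Ω : M → ℝ) (lam : ℝ)
    (hg : IsPoincareQuasiEinstein g Ω lam)
    (e : OpenPartialHomeomorph M H) (he : e ∈ IsManifold.maximalAtlas I ∞ M) :
    let S := range I
    let G := g.coord e
    let f := coordFun I e Ω
    let u := Coord.unitNormal S G f lam
    let K := Coord.levelSetK S G f lam
    let ε := Coord.normSq G u
    (∀ y ∈ (e.extend I).target, ε y = 1 ∨ ε y = -1) ∧
    (∀ y ∈ (e.extend I).target, f y ≠ 0 → ∀ b k : Fin n,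
      Coord.weylPerp S G f lam b k y
        = Coord.tensorSq G K b k y - Coord.lieDeriv S u K b k y
          + ε y / f y * Real.sqrt |lam| * K b k y) ∧
    (∃ Q : Fin n → Fin n → EuclideanSpace ℝ (Fin n) → ℝ,
      (∀ b k, ContDiffOn ℝ ∞ (Q b k) (e.extend I).target) ∧
      (∀ y ∈ (e.extend I).target, ∀ b k, f y * Q b k y = K b k y) ∧
      (∀ Q' : Fin n → Fin n → EuclideanSpace ℝ (Fin n) → ℝ,
        (∀ b k, ContinuousOn (Q' b k) (e.extend I).target) →
        (∀ y ∈ (e.extend I).target, ∀ b k, f y * Q' b k y = K b k y) →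
        ∀ y ∈ (e.extend I).target, ∀ b k, Q' b k y = Q b k y) ∧
      (∀ y ∈ (e.extend I).target, ∀ b k : Fin n,
        Coord.weylPerp S G f lam b k y
          = Coord.tensorSq G K b k y - Coord.lieDeriv S u K b k y
            + ε y * Real.sqrt |lam| * Q b k y)) := by
  intro S G f u K ε
  have h := hg.isPoincareQuasiEinsteinOn he
  -- The witness `Q = -|λ|^{-1/2} Sch` is read off from `K = -|λ|^{-1/2} Ω Sch`.
  refine ⟨fun y hy ↦ Coord.normSq_unitNormal h.ne_zero (h.norm_grad y hy), fun y hy hf b k ↦ ?_,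
    fun b k y ↦ -(√|lam|)⁻¹ * Coord.schouten S G b k y, fun b k y hy ↦ ?_,
    fun y hy b k ↦ (h.levelSetK_eq hy b k).symm, fun Q' hQ' hK y hy b k ↦ ?_,
    fun y hy b k ↦ h.weylPerp_eq hy b k⟩
  · have hK : K b k y = f y * (-(√|lam|)⁻¹ * Coord.schouten S G b k y) := h.levelSetK_eq hy b k
    rw [hK]
    refine (h.weylPerp_eq hy b k).trans ?_
    congr 1
    change ε y * _ * (_ * Coord.schouten S G b k y) = _
    field_simp
  · exact (contDiffWithinAt_const.mul (h.contDiffWithinAt_schouten hy b k)).mono h.subset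
  -- Uniqueness: `Q'` and `Q` agree where `Ω ≠ 0`, hence everywhere by continuity.
  · have hQ : ContinuousWithinAt (Q' b k) S y :=
      (hQ' b k y hy).mono_of_mem_nhdsWithin (h.mem_nhdsWithin y hy)
    refine Coord.eq_of_frequently_eq hQ (contDiffWithinAt_const.mul
      (h.contDiffWithinAt_schouten hy b k)).continuousWithinAt
      ((h.frequently hy).mono fun z hz ↦ mul_left_cancel₀ hz.1 ?_)
    exact (hK z hz.2 b k).trans (h.levelSetK_eq hz.2 b k)
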